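/- Let $M$ be a smooth manifold of dimension $n\ge 2$, let $\mathcal{T}M=TM\setminus\{0\}$ be its slit tangent bundle and $\mathcal{C}=y^i\,\partial/\partial y^i$ the Liouville vector field. A spray is a smooth vector field $S$ on $\mathcal{T}M$ with $JS=\mathcal{C}$ and $[\mathcal{C},S]=S$, where $J=\frac{\partial}{\partial y^i}\otimes dx^i$; in induced coordinates $S=y^i\frac{\partial}{\partial x^i}-2G^i\frac{\partial}{\partial y^i}$. A Finsler function is a continuous function $F\colon TM\to\mathbb{R}$ that vanishes exactly on the zero section, is smooth and positive on $\mathcal{T}M$, is positively $1$-homogeneous in $y$, and whose metric tensor $g_{ij}=\frac12\frac{\partial^2F^2}{\partial y^i\partial y^j}$ has maximal rank on $\mathcal{T}M$. A vector field $S$ on $\mathcal{T}M$ is called Finsler metrizable if it is the geodesic spray of some Finsler function $F$ on $M$, that is, $i_S\,dd_JE=-dE$ on $\mathcal{T}M$ with $E=\frac12F^2$. Let $S$ be a Finsler metrizable spray on $M$ and let $\mathcal{P}\colon\mathcal{T}M\to\mathbb{R}$ be a smooth, positively $1$-homogeneous function that is holonomy invariant with respect to $S$, i.e. invariant under the parallel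 translations along curves of $M$ defined by the nonlinear connection $G^i_j=\partial G^i/\partial y^j$ of $S$. Let $\Phi=R^i_j\,dx^j\otimes\frac{\partial}{\partial y^i}$, with $R^i_j=2\frac{\partial G^i}{\partial x^j}-S(G^i_j)-G^i_kG^k_j$, be the Jacobi endomorphism of $S$. At each point of $\mathcal{T}M$ let $\kappa_1,\dots,\kappa_n$ denote its eigenvalues, i.e. those of $(R^i_j)$: here $\kappa_1,\dots,\kappa_{n-1}$ are the principal curvatures of $S$, and $\kappa_n=0$ is the eigenvalue belonging to the eigenvector $S$. Let $\lambda\in\mathbb{R}$ be such that at some point $(x,y)\in\mathcal{T}M$ $$\kappa_\alpha(x,y)+\lambda^2\mathcal{P}^2(x,y)\neq 0\qquad\text{for all }\alpha=1,\dots,n$$ (in particular $\lambda\,\mathcal{P}(x,y)\ne0$). Then the projectively deformed spray $\widetilde S=S-2\lambda\mathcal{P}\,\mathcal{C}$ is not Finsler metrizable. -/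

import Mathlib

open scoped Manifold ContDiff

noncomputable section

namespace Finsler

section

variable {n : ℕ} {M : Type*} [TopologicalSpace M]
  [ChartedSpace (EuclideanSpace ℝ (Fin n)) M] [IsManifold (𝓡 n) ∞ M]

/-- The slit tangent bundle: the nonzero tangent vectors. -/
def slit (n : ℕ) (M : Type*) [TopologicalSpace M]
    [ChartedSpace (EuclideanSpace ℝ (Fin n)) M] [IsManifold (𝓡 n) ∞ M] :
    Set (TangentBundle (𝓡 n) M) :=
  {v | v.2 ≠ 0}

/-- The inclusion of the fibre `T_xM` into `TM`. -/
def fibreIncl (x : M) (y : EuclideanSpace ℝ (Fin n)) : TangentBundle (𝓡 n) M :=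
  ⟨x, y⟩

/-- Vertical lift of `w ∈ T_xM` to a tangent vector of `TM` at `v ∈ T_xM`: the derivative of the
inclusion of the fibre `T_xM` into `TM`. -/
def verticalLift (v : TangentBundle (𝓡 n) M) (w : EuclideanSpace ℝ (Fin n)) :
    TangentSpace (𝓡 n).tangent v :=
  mfderiv 𝓘(ℝ, EuclideanSpace ℝ (Fin n)) (𝓡 n).tangent (fibreIncl v.1) v.2 w

/-- The Liouville vector field `C = yⁱ ∂/∂yⁱ`. -/
def liouville (v : TangentBundle (𝓡 n) M) : TangentSpace (𝓡 n).tangent v :=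
  verticalLift v v.2

/-- The natural almost tangent structure `J = ∂/∂yⁱ ⊗ dxⁱ`. -/
def almostTangent (v : TangentBundle (𝓡 n) M) (ξ : TangentSpace (𝓡 n).tangent v) :
    TangentSpace (𝓡 n).tangent v :=
  verticalLift v (mfderiv (𝓡 n).tangent (𝓡 n)
    (fun u : TangentBundle (𝓡 n) M => u.1) v ξ)

/-- A spray: a vector field on `TM`, smooth on the slit tangent bundle, with `J S = C` and
`[C, S] = S` there. The values of `S` on the zero section are irrelevant. -/
structure IsSpray (S : (v : TangentBundle (𝓡 n) M) → TangentSpace (𝓡 n).tangent v) : Prop where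
  smooth : ContMDiffOn (𝓡 n).tangent (𝓡 n).tangent.tangent ∞
    (fun v => (⟨v, S v⟩ : TangentBundle (𝓡 n).tangent (TangentBundle (𝓡 n) M))) (slit n M)
  almostTangent_eq : ∀ v ∈ slit n M, almostTangent v (S v) = liouville v
  lie_eq : ∀ v ∈ slit n M, VectorField.mlieBracket (𝓡 n).tangent liouville S v = S v

/-- The projective deformation `S - 2 lam P C`. -/
def deform (S : (v : TangentBundle (𝓡 n) M) → TangentSpace (𝓡 n).tangent v) (lam : ℝ)
    (P : TangentBundle (𝓡 n) M → ℝ) :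
    (v : TangentBundle (𝓡 n) M) → TangentSpace (𝓡 n).tangent v :=
  fun v => S v - (2 * lam * P v) • liouville v

/-! ### Induced coordinates -/

/-- The induced coordinates `(x, y)` on `TM` over the chart of `M` around `x₀`. -/
def coords (x₀ : M) : PartialEquiv (TangentBundle (𝓡 n) M)
    (EuclideanSpace ℝ (Fin n) × EuclideanSpace ℝ (Fin n)) :=
  extChartAt (𝓡 n).tangent (⟨x₀, 0⟩ : TangentBundle (𝓡 n) M)

/-- A function on `TM` in the induced coordinates. -/
def funRep (x₀ : M) (f : TangentBundle (𝓡 n) M → ℝ)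
    (p : EuclideanSpace ℝ (Fin n) × EuclideanSpace ℝ (Fin n)) : ℝ :=
  f ((coords x₀).symm p)

/-- The components in the induced coordinates of a tangent vector of `TM` at `v`. -/
def vecRep (x₀ : M) (v : TangentBundle (𝓡 n) M) (ξ : TangentSpace (𝓡 n).tangent v) :
    EuclideanSpace ℝ (Fin n) × EuclideanSpace ℝ (Fin n) :=
  mfderiv (𝓡 n).tangent 𝓘(ℝ, EuclideanSpace ℝ (Fin n) × EuclideanSpace ℝ (Fin n))
    (coords x₀) v ξ

/-- A vector field on `TM` in the induced coordinates. -/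
def fieldRep (x₀ : M) (S : (v : TangentBundle (𝓡 n) M) → TangentSpace (𝓡 n).tangent v)
    (p : EuclideanSpace ℝ (Fin n) × EuclideanSpace ℝ (Fin n)) :
    EuclideanSpace ℝ (Fin n) × EuclideanSpace ℝ (Fin n) :=
  vecRep x₀ ((coords x₀).symm p) (S ((coords x₀).symm p))

/-! ### Finsler functions and their geodesic sprays -/

/-- The energy `E = F² / 2`. -/
def energy (F : TangentBundle (𝓡 n) M → ℝ) (v : TangentBundle (𝓡 n) M) : ℝ :=
  F v ^ 2 / 2

/-- The metric tensor `g(u, w) = ½ ∂²F²/∂yⁱ∂yʲ uⁱ wʲ` in the induced coordinates. -/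
def metricTensor (x₀ : M) (F : TangentBundle (𝓡 n) M → ℝ)
    (p : EuclideanSpace ℝ (Fin n) × EuclideanSpace ℝ (Fin n))
    (u w : EuclideanSpace ℝ (Fin n)) : ℝ :=
  fderiv ℝ (fun q => fderiv ℝ (funRep x₀ (energy F)) q (0, w)) p (0, u)

/-- A Finsler function. -/
structure IsFinsler (F : TangentBundle (𝓡 n) M → ℝ) : Prop where
  continuous : Continuous F
  smooth : ContMDiffOn (𝓡 n).tangent 𝓘(ℝ, ℝ) ∞ F (slit n M)
  pos : ∀ v ∈ slit n M, 0 < F v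
  zero : ∀ x : M, F ⟨x, 0⟩ = 0
  homogeneous : ∀ v : TangentBundle (𝓡 n) M, ∀ t : ℝ, 0 < t → F ⟨v.1, t • v.2⟩ = t * F v
  nondegenerate : ∀ x₀ : M, ∀ p ∈ (coords x₀).target, p.2 ≠ 0 →
    ∀ u : EuclideanSpace ℝ (Fin n), (∀ w, metricTensor x₀ F p u w = 0) → u = 0

/-- The 1-form `d_J f = df ∘ J = ∂f/∂yⁱ dxⁱ` in the induced coordinates. -/
def dJ (x₀ : M) (f : TangentBundle (𝓡 n) M → ℝ)
    (p : EuclideanSpace ℝ (Fin n) × EuclideanSpace ℝ (Fin n)) :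
    EuclideanSpace ℝ (Fin n) × EuclideanSpace ℝ (Fin n) →L[ℝ] ℝ :=
  (fderiv ℝ (funRep x₀ f) p).comp
    ((ContinuousLinearMap.inr ℝ (EuclideanSpace ℝ (Fin n)) (EuclideanSpace ℝ (Fin n))).comp
      (ContinuousLinearMap.fst ℝ (EuclideanSpace ℝ (Fin n)) (EuclideanSpace ℝ (Fin n))))

/-- The value `(d d_J f)(ξ, η)` of the exterior derivative of `d_J f`, in the induced
coordinates. -/
def ddJ (x₀ : M) (f : TangentBundle (𝓡 n) M → ℝ)
    (p ξ η : EuclideanSpace ℝ (Fin n) × EuclideanSpace ℝ (Fin n)) : ℝ :=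
  fderiv ℝ (dJ x₀ f) p ξ η - fderiv ℝ (dJ x₀ f) p η ξ

/-- `S` satisfies the Euler-Lagrange equation `i_S d d_J E = - dE` of the energy `E` of `F` on
the slit tangent bundle. -/
def IsGeodesicSpray (F : TangentBundle (𝓡 n) M → ℝ)
    (S : (v : TangentBundle (𝓡 n) M) → TangentSpace (𝓡 n).tangent v) : Prop :=
  ∀ x₀ : M, ∀ p ∈ (coords x₀).target, p.2 ≠ 0 →
    ∀ η : EuclideanSpace ℝ (Fin n) × EuclideanSpace ℝ (Fin n),
      ddJ x₀ (energy F) p (fieldRep x₀ S p) η = - fderiv ℝ (funRep x₀ (energy F)) p η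

/-- `S` is the geodesic spray of some Finsler function. -/
def IsFinslerMetrizable
    (S : (v : TangentBundle (𝓡 n) M) → TangentSpace (𝓡 n).tangent v) : Prop :=
  ∃ F : TangentBundle (𝓡 n) M → ℝ, IsFinsler F ∧ IsGeodesicSpray F S

/-! ### The nonlinear connection and the Jacobi endomorphism of a spray -/

/-- The spray coefficients `G`: in the induced coordinates `S = yⁱ ∂/∂xⁱ - 2 Gⁱ ∂/∂yⁱ`. -/
def sprayCoeff (x₀ : M) (S : (v : TangentBundle (𝓡 n) M) → TangentSpace (𝓡 n).tangent v)
    (p : EuclideanSpace ℝ (Fin n) × EuclideanSpace ℝ (Fin n)) : EuclideanSpace ℝ (Fin n) :=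
  (-(1 / 2) : ℝ) • (fieldRep x₀ S p).2

/-- The connection coefficients `Gⁱⱼ = ∂Gⁱ/∂yʲ`. -/
def connCoeff (x₀ : M) (S : (v : TangentBundle (𝓡 n) M) → TangentSpace (𝓡 n).tangent v)
    (p : EuclideanSpace ℝ (Fin n) × EuclideanSpace ℝ (Fin n)) :
    EuclideanSpace ℝ (Fin n) →L[ℝ] EuclideanSpace ℝ (Fin n) :=
  (fderiv ℝ (sprayCoeff x₀ S) p).comp
    (ContinuousLinearMap.inr ℝ (EuclideanSpace ℝ (Fin n)) (EuclideanSpace ℝ (Fin n)))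

/-- The components `Rⁱⱼ = 2 ∂Gⁱ/∂xʲ - S(Gⁱⱼ) - Gⁱₖ Gᵏⱼ` of the Jacobi endomorphism
`Φ = Rⁱⱼ dxʲ ⊗ ∂/∂yⁱ`. -/
def jacobi (x₀ : M) (S : (v : TangentBundle (𝓡 n) M) → TangentSpace (𝓡 n).tangent v)
    (p : EuclideanSpace ℝ (Fin n) × EuclideanSpace ℝ (Fin n)) :
    EuclideanSpace ℝ (Fin n) →L[ℝ] EuclideanSpace ℝ (Fin n) :=
  (2 : ℝ) • (fderiv ℝ (sprayCoeff x₀ S) p).comp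
      (ContinuousLinearMap.inl ℝ (EuclideanSpace ℝ (Fin n)) (EuclideanSpace ℝ (Fin n)))
    - fderiv ℝ (connCoeff x₀ S) p (fieldRep x₀ S p)
    - (connCoeff x₀ S p).comp (connCoeff x₀ S p)

/-- `κ` is an eigenvalue of the Jacobi endomorphism at `v`: `Φ(X) = κ J X` for some horizontal
`X = Xⁱ δᵢ ≠ 0` at `v`, that is `Rⁱⱼ Xʲ = κ Xⁱ`. These are the principal curvatures at `v`
together with the eigenvalue `0` belonging to `X = S`. -/
def IsJacobiEigenvalue (S : (v : TangentBundle (𝓡 n) M) → TangentSpace (𝓡 n).tangent v)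
    (v : TangentBundle (𝓡 n) M) (κ : ℝ) : Prop :=
  ∃ X : EuclideanSpace ℝ (Fin n), X ≠ 0 ∧ jacobi v.1 S (coords v.1 v) X = κ • X

/-- The tangent vector `ξ` of `TM` at `v` is horizontal, that is `δyⁱ(ξ) = 0` for
`δyⁱ = dyⁱ + Gⁱⱼ dxʲ`. Horizontality does not depend on the chart, so it is tested in any chart
around the base point. -/
def IsHorizontal (S : (v : TangentBundle (𝓡 n) M) → TangentSpace (𝓡 n).tangent v)
    (v : TangentBundle (𝓡 n) M) (ξ : TangentSpace (𝓡 n).tangent v) : Prop :=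
  ∃ x₀ : M, v ∈ (coords x₀).source ∧
    (vecRep x₀ v ξ).2 + connCoeff x₀ S (coords x₀ v) (vecRep x₀ v ξ).1 = 0

/-- `γ(t) = (c(t), Y(t))`, `t ∈ [a, b]`, is a parallel nonzero vector field `Y` along the `C¹`
curve `c` of `M`, that is a horizontal lift of `c`: the parallel translation along `c` carries
`γ(a)` to `γ(b)`. -/
def IsParallel (S : (v : TangentBundle (𝓡 n) M) → TangentSpace (𝓡 n).tangent v)
    (γ : ℝ → TangentBundle (𝓡 n) M) (a b : ℝ) : Prop :=
  ContMDiffOn 𝓘(ℝ, ℝ) (𝓡 n).tangent 1 γ (Set.Icc a b) ∧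
    ∀ t ∈ Set.Icc a b, γ t ∈ slit n M ∧
      IsHorizontal S (γ t) (mfderivWithin 𝓘(ℝ, ℝ) (𝓡 n).tangent γ (Set.Icc a b) t (1 : ℝ))

/-- `P` is invariant under the parallel translations of `S`. -/
def IsHolonomyInvariant (S : (v : TangentBundle (𝓡 n) M) → TangentSpace (𝓡 n).tangent v)
    (P : TangentBundle (𝓡 n) M → ℝ) : Prop :=
  ∀ (γ : ℝ → TangentBundle (𝓡 n) M) (a b : ℝ), a ≤ b → IsParallel S γ a b → P (γ a) = P (γ b)

end

end Finsler

end

/-! Everything is local in induced coordinates near the given point. Write `N` for the connection of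
`S`, δ_u for the horizontal lift of u, Φ for the Jacobi endomorphism, and subscripts for vertical
derivatives. Suppose the deformed spray had an energy e', and put f = log e'. An energy is constant
along its own spray and along that spray's horizontal distribution. Rewriting this in terms of `S`
gives S f = 4λP and δ_u f = λ(P f_u + 2 P_u), while holonomy invariance gives S P = 0 and δ_u P = 0.

Applying [S, δ_u] = δ_{Nu} + Φu to P shows that d_yP vanishes on the image of Φ. Applying it to f
shows that the covector ω = P d_yf - 2 d_yP vanishes on the image of Φ + λ²P² (`log_sub_jacobiEnd`).
The eigenvalue hypothesis makes Φ + λ²P² invertible at the point, hence in a neighbourhood, so ω = 0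
there: along the fibres e' is locally a constant multiple of P².

Now δ_w f = 4λ P_w, and the bracket [∂_u, δ_w] applied to f and to P forces 4λP P_{uw} = 0, so P is
affine along the fibres (`P_vert_vert`). The fibre Hessian of e' then has rank at most one, which
contradicts its nondegeneracy because n ≥ 2 (`false_of_log_eq`). -/

noncomputable section

namespace Finsler

/-! ### Second derivatives and commutators of vector fields in a normed space. -/

section Calculus

variable {X F : Type*} [NormedAddCommGroup X] [NormedSpace ℝ X]
  [NormedAddCommGroup F] [NormedSpace ℝ F]

theorem differentiableAt_fderiv_of_contDiffAt {f : X → F} {p : X} (hf : ContDiffAt ℝ ∞ f p) :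
    DifferentiableAt ℝ (fderiv ℝ f) p :=
  (hf.fderiv_right (m := ∞) (by simp)).differentiableAt (by simp)

theorem fderiv_fderiv_apply {f : X → F} {Y : X → X} {p : X} (hf : ContDiffAt ℝ ∞ f p)
    (hY : DifferentiableAt ℝ Y p) (v : X) :
    fderiv ℝ (fun q => fderiv ℝ f q (Y q)) p v =
      fderiv ℝ (fderiv ℝ f) p v (Y p) + fderiv ℝ f p (fderiv ℝ Y p v) := by
  rw [fderiv_clm_apply (differentiableAt_fderiv_of_contDiffAt hf) hY]
  simp [add_comm]

theorem fderiv_fderiv_const {f : X → F} {p : X} (hf : ContDiffAt ℝ ∞ f p) (w v : X) :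
    fderiv ℝ (fun q => fderiv ℝ f q w) p v = fderiv ℝ (fderiv ℝ f) p v w := by
  rw [fderiv_fderiv_apply hf (differentiableAt_const w)]
  simp

theorem fderiv_fderiv_symm {f : X → F} {p : X} (hf : ContDiffAt ℝ ∞ f p) (v w : X) :
    fderiv ℝ (fderiv ℝ f) p v w = fderiv ℝ (fderiv ℝ f) p w v :=
  (hf.isSymmSndFDerivAt (by simp; exact WithTop.coe_le_coe.2 le_top)) v w

/-- The commutator of two derivations is the derivation along the Lie bracket. -/
theorem fderiv_commutator {f : X → F} {Y Z : X → X} {p : X} (hf : ContDiffAt ℝ ∞ f p)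
    (hY : DifferentiableAt ℝ Y p) (hZ : DifferentiableAt ℝ Z p) :
    fderiv ℝ (fun q => fderiv ℝ f q (Z q)) p (Y p) -
      fderiv ℝ (fun q => fderiv ℝ f q (Y q)) p (Z p) =
      fderiv ℝ f p (fderiv ℝ Z p (Y p) - fderiv ℝ Y p (Z p)) := by
  rw [fderiv_fderiv_apply hf hY, fderiv_fderiv_apply hf hZ, fderiv_fderiv_symm hf (Y p) (Z p),
    map_sub]
  abel

theorem contDiffAt_fderiv_const {f : X → F} {p : X} (hf : ContDiffAt ℝ ∞ f p) (w : X) :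
    ContDiffAt ℝ ∞ (fun q => fderiv ℝ f q w) p :=
  (hf.fderiv_right (m := ∞) (by simp)).clm_apply contDiffAt_const

theorem fderiv_eq_of_eqOn {f g : X → F} {V : Set X} (hV : IsOpen V) (h : ∀ q ∈ V, f q = g q)
    {p : X} (hp : p ∈ V) : fderiv ℝ f p = fderiv ℝ g p :=
  Filter.EventuallyEq.fderiv_eq (Filter.eventually_of_mem (hV.mem_nhds hp) h)

end Calculus

/-! ### Brackets of a spray with its horizontal and vertical fields. -/

section Spray

variable {E : Type*} [NormedAddCommGroup E] [NormedSpace ℝ E]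

/-- The spray `yⁱ ∂/∂xⁱ - 2 Gⁱ ∂/∂yⁱ` with coefficients `G`. -/
def sprayField (G : E × E → E) (q : E × E) : E × E := (q.2, -(2 : ℝ) • G q)

/-- The connection `Gⁱⱼ = ∂Gⁱ/∂yʲ`. -/
def conn (G : E × E → E) (q : E × E) : E →L[ℝ] E :=
  (fderiv ℝ G q).comp (ContinuousLinearMap.inr ℝ E E)

/-- The horizontal lift of `u`. -/
def horLift (G : E × E → E) (u : E) (q : E × E) : E × E := (u, -conn G q u)

/-- The Jacobi endomorphism of the spray with coefficients `G`. -/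
def jacobiEnd (G : E × E → E) (p : E × E) : E →L[ℝ] E :=
  (2 : ℝ) • (fderiv ℝ G p).comp (ContinuousLinearMap.inl ℝ E E)
    - fderiv ℝ (conn G) p (sprayField G p) - (conn G p).comp (conn G p)

variable {G : E × E → E} {p : E × E}

theorem conn_apply (u : E) : conn G p u = fderiv ℝ G p (0, u) := rfl

theorem contDiffAt_conn (hG : ContDiffAt ℝ ∞ G p) : ContDiffAt ℝ ∞ (conn G) p :=
  (hG.fderiv_right (m := ∞) (by simp)).clm_comp contDiffAt_const

theorem hasFDerivAt_sprayField (hG : ContDiffAt ℝ ∞ G p) :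
    HasFDerivAt (sprayField G)
      ((ContinuousLinearMap.snd ℝ E E).prod (-(2 : ℝ) • fderiv ℝ G p)) p :=
  (ContinuousLinearMap.snd ℝ E E).hasFDerivAt.prodMk
    ((hG.differentiableAt (by simp)).hasFDerivAt.const_smul (-2 : ℝ))

theorem hasFDerivAt_horLift (hG : ContDiffAt ℝ ∞ G p) (u : E) :
    HasFDerivAt (horLift G u)
      ((0 : E × E →L[ℝ] E).prod (-((fderiv ℝ (conn G) p).flip u))) p := by
  have h := ((contDiffAt_conn hG).differentiableAt (by simp)).hasFDerivAt.clm_apply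
    (hasFDerivAt_const u p)
  refine (hasFDerivAt_const u p).prodMk (HasFDerivAt.neg ?_)
  simpa using h

theorem horLift_apply {f : E × E → ℝ} (u : E) :
    fderiv ℝ f p (horLift G u p) = fderiv ℝ f p (u, 0) - fderiv ℝ f p (0, conn G p u) := by
  rw [← map_sub]; simp [horLift]

variable {f : E × E → ℝ}

/-- `[S, δ_u] = δ_{N u} + Φ u`. -/
theorem commutator_spray_hor (hf : ContDiffAt ℝ ∞ f p) (hG : ContDiffAt ℝ ∞ G p) (u : E) :
    fderiv ℝ (fun q => fderiv ℝ f q (horLift G u q)) p (sprayField G p) -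
      fderiv ℝ (fun q => fderiv ℝ f q (sprayField G q)) p (horLift G u p) =
      fderiv ℝ f p (horLift G (conn G p u) p) + fderiv ℝ f p (0, jacobiEnd G p u) := by
  rw [fderiv_commutator hf (hasFDerivAt_sprayField hG).differentiableAt
    (hasFDerivAt_horLift hG u).differentiableAt, (hasFDerivAt_sprayField hG).fderiv,
    (hasFDerivAt_horLift hG u).fderiv, ← map_add]
  congr 1
  have h : fderiv ℝ G p (u, -conn G p u) = fderiv ℝ G p (u, 0) - conn G p (conn G p u) := by
    rw [conn_apply (conn G p u), ← map_sub]; simp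
  ext1
  · simp [horLift]
  · simp only [horLift, jacobiEnd, ContinuousLinearMap.prod_apply, Prod.snd_sub, Prod.snd_add,
      _root_.neg_apply, ContinuousLinearMap.flip_apply, _root_.smul_apply,
      h, _root_.sub_apply, ContinuousLinearMap.comp_apply,
      ContinuousLinearMap.inl_apply]
    module

/-- `[∂/∂y_w, S] = δ_w - N w`. -/
theorem commutator_vert_spray (hf : ContDiffAt ℝ ∞ f p) (hG : ContDiffAt ℝ ∞ G p) (w : E) :
    fderiv ℝ (fun q => fderiv ℝ f q (sprayField G q)) p (0, w) -
      fderiv ℝ (fun q => fderiv ℝ f q (0, w)) p (sprayField G p) =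
      fderiv ℝ f p (horLift G w p) - fderiv ℝ f p (0, conn G p w) := by
  have h := fderiv_commutator (Y := fun _ => (0, w)) hf (differentiableAt_const _)
    (hasFDerivAt_sprayField hG).differentiableAt
  rw [h, ← map_sub, (hasFDerivAt_sprayField hG).fderiv]
  congr 1
  ext1
  · simp [horLift]
  · simp [horLift, ← conn_apply]; module

/-- `[∂/∂y_w, δ_u] = - N_{uw}`. -/
theorem commutator_vert_hor (hf : ContDiffAt ℝ ∞ f p) (hG : ContDiffAt ℝ ∞ G p) (u w : E) :
    fderiv ℝ (fun q => fderiv ℝ f q (horLift G u q)) p (0, w) -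
      fderiv ℝ (fun q => fderiv ℝ f q (0, w)) p (horLift G u p) =
      - fderiv ℝ f p (0, fderiv ℝ (conn G) p (0, w) u) := by
  have h := fderiv_commutator (Y := fun _ => (0, w)) hf (differentiableAt_const _)
    (hasFDerivAt_horLift hG u).differentiableAt
  rw [h, ← map_neg, (hasFDerivAt_horLift hG u).fderiv]
  congr 1
  ext1 <;> simp

/-- `[C, S] = S - 2 (N y - 2 G)`. -/
theorem commutator_liouville_spray (hf : ContDiffAt ℝ ∞ f p) (hG : ContDiffAt ℝ ∞ G p) :
    fderiv ℝ (fun q => fderiv ℝ f q (sprayField G q)) p (0, p.2) -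
      fderiv ℝ (fun q => fderiv ℝ f q (0, q.2)) p (sprayField G p) =
      fderiv ℝ f p (sprayField G p) -
        2 * fderiv ℝ f p (0, conn G p p.2 - (2 : ℝ) • G p) := by
  have hC : HasFDerivAt (fun q : E × E => ((0 : E), q.2))
      ((0 : E × E →L[ℝ] E).prod (ContinuousLinearMap.snd ℝ E E)) p :=
    (hasFDerivAt_const 0 p).prodMk (ContinuousLinearMap.snd ℝ E E).hasFDerivAt
  have h := fderiv_commutator hf hC.differentiableAt
    (hasFDerivAt_sprayField hG).differentiableAt
  rw [h, ← smul_eq_mul, ← map_smul, ← map_sub, (hasFDerivAt_sprayField hG).fderiv, hC.fderiv]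
  congr 1
  ext1
  · simp [sprayField]
  · simp [sprayField, ← conn_apply]; module

end Spray

/-! ### Local consequences of the Euler-Lagrange equation. -/

section Energy

variable {E : Type*} [NormedAddCommGroup E] [NormedSpace ℝ E]

/-- The energy of a Finsler function, in the induced coordinates on an open set `V`. -/
structure IsEnergyOn (V : Set (E × E)) (e : E × E → ℝ) : Prop where
  smooth : ∀ p ∈ V, ContDiffAt ℝ ∞ e p
  pos : ∀ p ∈ V, 0 < e p
  euler : ∀ p ∈ V, fderiv ℝ e p (0, p.2) = 2 * e p
  nondegenerate : ∀ p ∈ V, ∀ u : E,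
    (∀ w, fderiv ℝ (fun q => fderiv ℝ e q (0, w)) p (0, u) = 0) → u = 0

/-- The Euler-Lagrange equation `i_Z d d_J e = - de` on `V`. -/
def EulerLagrangeOn (V : Set (E × E)) (e : E × E → ℝ) (Z : E × E → E × E) : Prop :=
  ∀ p ∈ V, ∀ η : E × E, fderiv ℝ (fun q => fderiv ℝ e q (0, η.1)) p (Z p) -
    fderiv ℝ (fun q => fderiv ℝ e q (0, (Z p).1)) p η = - fderiv ℝ e p η

variable {V : Set (E × E)} {e : E × E → ℝ}

theorem fderiv_liouville {f : E × E → ℝ} {p : E × E} (hf : ContDiffAt ℝ ∞ f p) (v : E × E) :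
    fderiv ℝ (fun q => fderiv ℝ f q (0, q.2)) p v =
      fderiv ℝ (fderiv ℝ f) p v (0, p.2) + fderiv ℝ f p (0, v.2) := by
  have hC : HasFDerivAt (fun q : E × E => ((0 : E), q.2))
      ((0 : E × E →L[ℝ] E).prod (ContinuousLinearMap.snd ℝ E E)) p :=
    (hasFDerivAt_const 0 p).prodMk (ContinuousLinearMap.snd ℝ E E).hasFDerivAt
  rw [fderiv_fderiv_apply hf hC.differentiableAt, hC.fderiv]
  simp

/-- The derivative of Euler's relation. -/
theorem IsEnergyOn.euler_fderiv (he : IsEnergyOn V e) (hV : IsOpen V) {p : E × E} (hp : p ∈ V)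
    (v : E × E) :
    fderiv ℝ (fderiv ℝ e) p v (0, p.2) + fderiv ℝ e p (0, v.2) = 2 * fderiv ℝ e p v := by
  rw [← fderiv_liouville (he.smooth p hp), fderiv_eq_of_eqOn hV he.euler hp,
    fderiv_const_mul ((he.smooth p hp).differentiableAt (by simp))]
  simp

/-- Testing the equation on vertical vectors and comparing with the vertical derivative of Euler's
relation places the difference of the two sides in the kernel of the metric tensor. -/
theorem EulerLagrangeOn.fst_eq {Z : E × E → E × E} (hZ : EulerLagrangeOn V e Z)
    (he : IsEnergyOn V e) (hV : IsOpen V) {p : E × E} (hp : p ∈ V) : (Z p).1 = p.2 := by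
  have hs := he.smooth p hp
  refine sub_eq_zero.1 (he.nondegenerate p hp _ fun w => ?_)
  have h1 := hZ p hp (0, w)
  have h2 := he.euler_fderiv hV hp (0, w)
  simp only [fderiv_fderiv_const hs] at h1 ⊢
  rw [fderiv_fderiv_symm hs]
  have h3 : ((0 : E), (Z p).1 - p.2) = (0, (Z p).1) - (0, p.2) := by simp
  have h4 : ((0 : E), (0 : E)) = 0 := rfl
  rw [h3, map_sub]
  simp only [h4, map_zero] at h1 h2
  linarith

variable {G : E × E → E}

/-- The classical form d/dt(∂e/∂y) = ∂e/∂x along geodesics, obtained by testing on (u, 0). -/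
theorem EulerLagrangeOn.spray_vert (hZ : EulerLagrangeOn V e (sprayField G))
    (he : IsEnergyOn V e) (hV : IsOpen V) {p : E × E} (hp : p ∈ V) (u : E) :
    fderiv ℝ (fun q => fderiv ℝ e q (0, u)) p (sprayField G p) = fderiv ℝ e p (u, 0) := by
  have hs := he.smooth p hp
  have h1 := hZ p hp (u, 0)
  have h2 := he.euler_fderiv hV hp (u, 0)
  simp only [fderiv_fderiv_const hs, sprayField] at h1 h2 ⊢
  have h4 : ((0 : E), (0 : E)) = 0 := rfl
  simp only [h4, map_zero] at h2
  linarith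

/-- The energy is constant along its geodesic spray. -/
theorem EulerLagrangeOn.spray_eq_zero (hZ : EulerLagrangeOn V e (sprayField G))
    (he : IsEnergyOn V e) (hV : IsOpen V) {p : E × E} (hp : p ∈ V) :
    fderiv ℝ e p (sprayField G p) = 0 := by
  have hs := he.smooth p hp
  -- The direction is frozen at the value y of the base point. Together with Euler's relation
  -- differentiated along S this yields S e = 2 S e.
  have h1 := hZ.spray_vert he hV hp p.2
  have h2 := he.euler_fderiv hV hp (sprayField G p)
  rw [fderiv_fderiv_const hs] at h1
  have h3 : fderiv ℝ e p (p.2, 0) + fderiv ℝ e p (0, (sprayField G p).2) =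
      fderiv ℝ e p (sprayField G p) := by
    rw [← map_add]; simp [sprayField]
  linarith

/-- The energy is constant along the horizontal distribution of its geodesic spray. -/
theorem EulerLagrangeOn.hor_eq_zero (hZ : EulerLagrangeOn V e (sprayField G))
    (he : IsEnergyOn V e) (hV : IsOpen V) {p : E × E} (hp : p ∈ V) (hG : ContDiffAt ℝ ∞ G p)
    (u : E) : fderiv ℝ e p (horLift G u p) = 0 := by
  have hs := he.smooth p hp
  -- Since S e = 0 and S(e_u) = e_(u,0) = δ_u e + e_{Nu}, the bracket identity becomes -δ_u e = δ_u
  -- e.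
  have h1 := commutator_vert_spray hs hG u
  rw [fderiv_eq_of_eqOn hV (fun q hq => hZ.spray_eq_zero he hV hq) hp,
    hZ.spray_vert he hV hp] at h1
  have h2 := horLift_apply (p := p) (G := G) (f := e) u
  simp at h1
  linarith

/-- The coefficients of a geodesic spray are 2-homogeneous. -/
theorem EulerLagrangeOn.conn_liouville (hZ : EulerLagrangeOn V e (sprayField G))
    (he : IsEnergyOn V e) (hV : IsOpen V) {p : E × E} (hp : p ∈ V) (hG : ContDiffAt ℝ ∞ G p) :
    conn G p p.2 = (2 : ℝ) • G p := by
  have hs := he.smooth p hp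
  refine sub_eq_zero.1 (he.nondegenerate p hp _ fun w => ?_)
  have hw := contDiffAt_fderiv_const hs ((0 : E), w)
  -- On e_w all terms of the bracket are known from the homogeneity of e, except the metric pairing
  -- of N y - 2G with w, which must therefore vanish.
  have h1 := commutator_liouville_spray hw hG
  rw [fderiv_eq_of_eqOn hV (fun q hq => hZ.spray_vert he hV hq w) hp,
    hZ.spray_vert he hV hp, fderiv_fderiv_const hs, fderiv_fderiv_symm hs] at h1
  have h0 : ∀ q ∈ V, fderiv ℝ (fun q => fderiv ℝ e q (0, w)) q (0, q.2) =
      fderiv ℝ e q (0, w) := fun q hq => by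
    have := he.euler_fderiv hV hq (0, w)
    rw [fderiv_fderiv_const (he.smooth q hq), fderiv_fderiv_symm (he.smooth q hq)]
    linarith
  rw [fderiv_eq_of_eqOn hV h0 hp, hZ.spray_vert he hV hp] at h1
  have h2 := he.euler_fderiv hV hp (w, 0)
  have h4 : ((0 : E), (0 : E)) = 0 := rfl
  simp only [h4, map_zero] at h2
  linarith

end Energy

/-! ### The contradiction between the two energies, on an open set of a vector space. -/

section Deformation

variable {E : Type*} [NormedAddCommGroup E] [NormedSpace ℝ E]
  {V : Set (E × E)} {G : E × E → E} {P : E × E → ℝ} {lam : ℝ}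

/-- A function that is constant along `S` and the horizontal distribution is annihilated by the
Jacobi endomorphism. -/
theorem fderiv_jacobiEnd_eq_zero (hV : IsOpen V) {f : E × E → ℝ} {p : E × E} (hp : p ∈ V)
    (hf : ContDiffAt ℝ ∞ f p) (hG : ContDiffAt ℝ ∞ G p)
    (hS : ∀ q ∈ V, fderiv ℝ f q (sprayField G q) = 0)
    (hδ : ∀ q ∈ V, ∀ u, fderiv ℝ f q (horLift G u q) = 0) (u : E) :
    fderiv ℝ f p (0, jacobiEnd G p u) = 0 := by
  have h := commutator_spray_hor hf hG u
  rw [fderiv_eq_of_eqOn hV hS hp, fderiv_eq_of_eqOn hV (fun q hq => hδ q hq u) hp,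
    hδ p hp] at h
  simpa using h.symm

theorem horLift_deform (hG : ∀ q ∈ V, ContDiffAt ℝ ∞ G q) (hP : ∀ q ∈ V, ContDiffAt ℝ ∞ P q)
    {p : E × E} (hp : p ∈ V) (u : E) :
    horLift (fun q => G q + (lam * P q) • q.2) u p =
      horLift G u p - (0, (lam * fderiv ℝ P p (0, u)) • p.2 + (lam * P p) • u) := by
  have h1 := ((hP p hp).differentiableAt (by simp)).hasFDerivAt.const_mul lam
  have h2 := ((hG p hp).differentiableAt (by simp)).hasFDerivAt.add
    (h1.smul (ContinuousLinearMap.snd ℝ E E).hasFDerivAt)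
  have h3 : HasFDerivAt (fun q => G q + (lam * P q) • q.2) _ p := h2
  ext1
  · simp [horLift]
  · simp [horLift, conn, h3.fderiv]
    module

/-- The data of a metrizable spray with coefficients `G`, a holonomy invariant `P`, and a second
energy `e'` that satisfies the Euler-Lagrange equation of the deformed spray. -/
structure DeformationData (V : Set (E × E)) (G : E × E → E) (P e' : E × E → ℝ) (lam : ℝ) :
    Prop where
  isOpen : IsOpen V
  G_smooth : ∀ p ∈ V, ContDiffAt ℝ ∞ G p
  G_hom : ∀ p ∈ V, conn G p p.2 = (2 : ℝ) • G p
  P_smooth : ∀ p ∈ V, ContDiffAt ℝ ∞ P p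
  P_hor : ∀ p ∈ V, ∀ u, fderiv ℝ P p (horLift G u p) = 0
  energy : IsEnergyOn V e'
  eulerLagrange : EulerLagrangeOn V e' (sprayField fun q => G q + (lam * P q) • q.2)

namespace DeformationData

variable {e' : E × E → ℝ} {p : E × E}

theorem P_spray (h : DeformationData V G P e' lam) (hp : p ∈ V) :
    fderiv ℝ P p (sprayField G p) = 0 := by
  rw [← h.P_hor p hp p.2, horLift, h.G_hom p hp, sprayField, neg_smul]

theorem coeff_smooth (h : DeformationData V G P e' lam) (hp : p ∈ V) :
    ContDiffAt ℝ ∞ (fun q => G q + (lam * P q) • q.2) p :=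
  (h.G_smooth p hp).add ((contDiffAt_const.mul (h.P_smooth p hp)).smul contDiffAt_snd)

theorem log_smooth (h : DeformationData V G P e' lam) (hp : p ∈ V) :
    ContDiffAt ℝ ∞ (fun q => Real.log (e' q)) p :=
  (h.energy.smooth p hp).log (h.energy.pos p hp).ne'

theorem fderiv_log (h : DeformationData V G P e' lam) (hp : p ∈ V) (v : E × E) :
    fderiv ℝ (fun q => Real.log (e' q)) p v = (e' p)⁻¹ * fderiv ℝ e' p v := by
  rw [fderiv.log ((h.energy.smooth p hp).differentiableAt (by simp)) (h.energy.pos p hp).ne']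
  simp

/-- The deformed spray S - 2λP C kills e', and C e' = 2e'; the logarithm removes e' from the
right-hand side. -/
theorem log_spray (h : DeformationData V G P e' lam) (hp : p ∈ V) :
    fderiv ℝ (fun q => Real.log (e' q)) p (sprayField G p) = 4 * lam * P p := by
  have h1 := h.eulerLagrange.spray_eq_zero h.energy h.isOpen hp
  have h2 := h.energy.euler p hp
  have h3 : sprayField (fun q => G q + (lam * P q) • q.2) p =
      sprayField G p - (2 * lam * P p) • ((0 : E), p.2) := by
    ext1
    · simp [sprayField]
    · simp [sprayField]; module
  rw [h3, map_sub, map_smul, h2, smul_eq_mul] at h1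
  have h4 := (h.energy.pos p hp).ne'
  rw [h.fderiv_log hp, sub_eq_zero.1 h1]
  field_simp
  ring

/-- The deformed horizontal lift δ_u - λ P_u C - λP ∂_u kills e', and C log e' = 2. -/
theorem log_hor (h : DeformationData V G P e' lam) (hp : p ∈ V) (u : E) :
    fderiv ℝ (fun q => Real.log (e' q)) p (horLift G u p) =
      lam * (P p * fderiv ℝ (fun q => Real.log (e' q)) p (0, u) +
        2 * fderiv ℝ P p (0, u)) := by
  have h1 := h.eulerLagrange.hor_eq_zero h.energy h.isOpen hp (h.coeff_smooth hp) u
  have h2 := h.energy.euler p hp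
  have h3 : ((0 : E), (lam * fderiv ℝ P p (0, u)) • p.2 + (lam * P p) • u) =
      (lam * fderiv ℝ P p (0, u)) • ((0 : E), p.2) + (lam * P p) • ((0 : E), u) := by
    simp
  rw [horLift_deform h.G_smooth h.P_smooth hp, map_sub, h3, map_add, map_smul, map_smul, h2,
    smul_eq_mul, smul_eq_mul] at h1
  have h4 := (h.energy.pos p hp).ne'
  rw [h.fderiv_log hp, h.fderiv_log hp, sub_eq_zero.1 h1]
  field_simp
  ring

/-- The covector `P d_y log e' - 2 d_y P` is an eigenvector of the transposed Jacobi
endomorphism for the eigenvalue `- λ² P²`. -/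
theorem log_sub_jacobiEnd (h : DeformationData V G P e' lam) (hp : p ∈ V) (u : E) :
    P p * fderiv ℝ (fun q => Real.log (e' q)) p
        (0, jacobiEnd G p u + (lam ^ 2 * P p ^ 2) • u) -
      2 * fderiv ℝ P p (0, jacobiEnd G p u + (lam ^ 2 * P p ^ 2) • u) = 0 := by
  set f : E × E → ℝ := fun q => Real.log (e' q) with hfdef
  have hV := h.isOpen
  have hf : ContDiffAt ℝ ∞ f p := h.log_smooth hp
  have hP := h.P_smooth p hp
  have hG := h.G_smooth p hp
  have hPd := hP.differentiableAt (by simp : (∞ : WithTop ℕ∞) ≠ 0)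
  have hfu := (contDiffAt_fderiv_const hf ((0 : E), u)).differentiableAt (by simp)
  have hPu := (contDiffAt_fderiv_const hP ((0 : E), u)).differentiableAt (by simp)
  have hPR := fderiv_jacobiEnd_eq_zero hV hp hP hG (fun q hq => h.P_spray hq) h.P_hor u
  have hSP : fderiv ℝ (fun q => fderiv ℝ P q (0, u)) p (sprayField G p) =
      fderiv ℝ P p (0, conn G p u) := by
    have := commutator_vert_spray hP hG u
    rw [fderiv_eq_of_eqOn hV (fun q hq => h.P_spray hq) hp, h.P_hor p hp] at this
    simp at this
    linarith
  have hSf : fderiv ℝ (fun q => fderiv ℝ f q (0, u)) p (sprayField G p) =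
      2 * lam * fderiv ℝ P p (0, u) - lam * P p * fderiv ℝ f p (0, u) +
        fderiv ℝ f p (0, conn G p u) := by
    have := commutator_vert_spray hf hG u
    rw [fderiv_eq_of_eqOn hV (fun q hq => h.log_spray hq) hp, h.log_hor hp,
      fderiv_const_mul hPd, _root_.smul_apply, smul_eq_mul] at this
    linarith
  have hhor : ∀ q ∈ V, ∀ w, fderiv ℝ f q (horLift G w q) =
      lam * (P q * fderiv ℝ f q (0, w) + 2 * fderiv ℝ P q (0, w)) :=
    fun q hq w => h.log_hor hq w
  have hc := commutator_spray_hor hf hG u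
  rw [fderiv_eq_of_eqOn hV (fun q hq => h.log_spray hq) hp,
    fderiv_eq_of_eqOn hV (fun q hq => hhor q hq u) hp, hhor p hp,
    fderiv_const_mul hPd, _root_.smul_apply, h.P_hor p hp,
    fderiv_const_mul ((hPd.fun_mul hfu).fun_add (hPu.const_mul 2)),
    fderiv_fun_add (hPd.fun_mul hfu) (hPu.const_mul 2), fderiv_fun_mul hPd hfu,
    fderiv_const_mul hPu] at hc
  simp only [_root_.smul_apply, _root_.add_apply, smul_eq_mul] at hc
  rw [hSP, hSf, h.P_spray hp] at hc
  have hsplit : ((0 : E), jacobiEnd G p u + (lam ^ 2 * P p ^ 2) • u) =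
      (0, jacobiEnd G p u) + (lam ^ 2 * P p ^ 2) • ((0 : E), u) := by simp
  rw [hsplit, map_add, map_add, map_smul, map_smul, hPR, smul_eq_mul, smul_eq_mul]
  -- The terms in N u cancel and `hc` reduces to f_{Φu} = λ²P(2P_u - P f_u). The factor P turns this
  -- into a statement about ω, as P_{Φu} = 0.
  linear_combination (-P p) * hc

/-- If `d_y log e' = 2 d_y log |P|` then `P` is affine along the fibres. -/
theorem P_vert_vert (h : DeformationData V G P e' lam) (hlam : lam ≠ 0)
    (hP0 : ∀ q ∈ V, P q ≠ 0)
    (hω : ∀ q ∈ V, ∀ u, P q * fderiv ℝ (fun q => Real.log (e' q)) q (0, u) =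
      2 * fderiv ℝ P q (0, u)) (hp : p ∈ V) (u w : E) :
    fderiv ℝ (fun q => fderiv ℝ P q (0, w)) p (0, u) = 0 := by
  set f : E × E → ℝ := fun q => Real.log (e' q) with hfdef
  have hV := h.isOpen
  have hf : ContDiffAt ℝ ∞ f p := h.log_smooth hp
  have hP := h.P_smooth p hp
  have hG := h.G_smooth p hp
  have hPd := hP.differentiableAt (by simp : (∞ : WithTop ℕ∞) ≠ 0)
  have hfu := (contDiffAt_fderiv_const hf ((0 : E), u)).differentiableAt (by simp)
  have hPw := (contDiffAt_fderiv_const hP ((0 : E), w)).differentiableAt (by simp)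
  have hPu := (contDiffAt_fderiv_const hP ((0 : E), u)).differentiableAt (by simp)
  have hhor : ∀ q ∈ V, fderiv ℝ f q (horLift G w q) = 4 * lam * fderiv ℝ P q (0, w) :=
    fun q hq => by rw [h.log_hor hq, hω q hq]; ring
  have h1 := commutator_vert_hor hf hG w u
  have h2 := commutator_vert_hor hP hG w u
  rw [fderiv_eq_of_eqOn hV hhor hp, fderiv_const_mul hPw, _root_.smul_apply, smul_eq_mul] at h1
  rw [fderiv_eq_of_eqOn hV (fun q hq => h.P_hor q hq w) hp] at h2
  -- Differentiating P f_u = 2 P_u along δ_w, where δ_w P = 0, gives P δ_w f_u = 2 δ_w P_u. The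
  -- brackets of f and 2P then agree except for the term 4λP P_{uw}.
  have h3 := DFunLike.congr_fun (fderiv_eq_of_eqOn hV (fun q hq => hω q hq u) hp)
    (horLift G w p)
  rw [fderiv_fun_mul hPd hfu, fderiv_const_mul hPu] at h3
  simp only [_root_.smul_apply, _root_.add_apply, smul_eq_mul, h.P_hor p hp, mul_zero,
    add_zero] at h3
  have h4 := hω p hp (fderiv ℝ (conn G) p (0, u) w)
  simp only [fderiv_fun_const, Pi.zero_apply, _root_.zero_apply] at h2
  have h5 : (4 * lam * P p) * fderiv ℝ (fun q => fderiv ℝ P q (0, w)) p (0, u) = 0 := by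
    linear_combination P p * h1 + h3 - 2 * h2 - h4
  have h6 : 4 * lam * P p ≠ 0 := mul_ne_zero (mul_ne_zero (by norm_num) hlam) (hP0 p hp)
  exact (mul_eq_zero.1 h5).resolve_left h6

/-- Allows passing to the neighbourhood where P ≠ 0 and Φ + λ²P² is invertible. -/
theorem mono (h : DeformationData V G P e' lam) {W : Set (E × E)} (hW : IsOpen W)
    (hWV : W ⊆ V) : DeformationData W G P e' lam where
  isOpen := hW
  G_smooth p hp := h.G_smooth p (hWV hp)
  G_hom p hp := h.G_hom p (hWV hp)
  P_smooth p hp := h.P_smooth p (hWV hp)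
  P_hor p hp := h.P_hor p (hWV hp)
  energy := ⟨fun p hp => h.energy.smooth p (hWV hp), fun p hp => h.energy.pos p (hWV hp),
    fun p hp => h.energy.euler p (hWV hp), fun p hp => h.energy.nondegenerate p (hWV hp)⟩
  eulerLagrange p hp := h.eulerLagrange p (hWV hp)

/-- The metric tensor of `e'` degenerates if `d_y log e' = 2 d_y log |P|`. -/
theorem false_of_log_eq [FiniteDimensional ℝ E] (hdim : 2 ≤ Module.finrank ℝ E)
    (h : DeformationData V G P e' lam) (hlam : lam ≠ 0)
    (hP0 : ∀ q ∈ V, P q ≠ 0)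
    (hω : ∀ q ∈ V, ∀ u, P q * fderiv ℝ (fun q => Real.log (e' q)) q (0, u) =
      2 * fderiv ℝ P q (0, u)) (hp : p ∈ V) : False := by
  -- A linear form on a space of dimension at least 2 has a nonzero kernel vector; it will lie in
  -- the kernel of the metric tensor of e'.
  obtain ⟨u, hu, hu0⟩ : ∃ u : E, fderiv ℝ P p (0, u) = 0 ∧ u ≠ 0 := by
    let φ : E →ₗ[ℝ] ℝ := ((fderiv ℝ P p).comp (ContinuousLinearMap.inr ℝ E E)).toLinearMap
    have hker : LinearMap.ker φ ≠ ⊥ := φ.ker_ne_bot_of_finrank_lt (by rw [Module.finrank_self]; lia)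
    obtain ⟨u, hu, hu0⟩ := Submodule.exists_mem_ne_zero_of_ne_bot hker
    exact ⟨u, hu, hu0⟩
  refine hu0 (h.energy.nondegenerate p hp u fun w => ?_)
  have he := h.energy.smooth p hp
  have hP := h.P_smooth p hp
  have heq : ∀ v, ∀ q ∈ V, P q * fderiv ℝ e' q (0, v) = 2 * (e' q * fderiv ℝ P q (0, v)) :=
    fun v q hq => by
      have := hω q hq v
      rw [h.fderiv_log hq] at this
      have h4 := (h.energy.pos q hq).ne'
      field_simp at this
      linarith
  have heu : fderiv ℝ e' p (0, u) = 0 := by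
    have := heq u p hp
    rw [hu] at this
    simpa [hP0 p hp] using this
  have hPd := hP.differentiableAt (by simp : (∞ : WithTop ℕ∞) ≠ 0)
  have hed := he.differentiableAt (by simp : (∞ : WithTop ℕ∞) ≠ 0)
  have hew := (contDiffAt_fderiv_const he ((0 : E), w)).differentiableAt (by simp)
  have hPw := (contDiffAt_fderiv_const hP ((0 : E), w)).differentiableAt (by simp)
  have h3 := DFunLike.congr_fun (fderiv_eq_of_eqOn h.isOpen (heq w) hp) ((0 : E), u)
  rw [fderiv_fun_mul hPd hew, fderiv_const_mul (hed.fun_mul hPw), fderiv_fun_mul hed hPw] at h3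
  simp only [_root_.smul_apply, _root_.add_apply, smul_eq_mul, hu, heu,
    h.P_vert_vert hlam hP0 hω hp] at h3
  simpa [hP0 p hp] using h3

end DeformationData

theorem jacobiEnd_continuousAt [FiniteDimensional ℝ E] {p : E × E} (hG : ContDiffAt ℝ ∞ G p) :
    ContinuousAt (jacobiEnd G) p := by
  have h1 := (hG.fderiv_right (m := ∞) (by simp)).continuousAt
  have h2 := ((contDiffAt_conn hG).fderiv_right (m := ∞) (by simp)).continuousAt
  have h3 := (contDiffAt_conn hG).continuousAt
  have h4 := (hasFDerivAt_sprayField hG).continuousAt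
  exact (((h1.clm_comp continuousAt_const).const_smul (2 : ℝ)).sub (h2.clm_apply h4)).sub
    (h3.clm_comp h3)

/-- The projective deformation of a geodesic spray by a holonomy invariant function does not
satisfy the Euler-Lagrange equation of an energy. -/
theorem DeformationData.false [FiniteDimensional ℝ E] (hdim : 2 ≤ Module.finrank ℝ E)
    {e e' : E × E → ℝ} {p : E × E} (h : DeformationData V G P e' lam) (he : IsEnergyOn V e)
    (hEL : EulerLagrangeOn V e (sprayField G)) (hp : p ∈ V)
    (hκ : ∀ u, jacobiEnd G p u + (lam ^ 2 * P p ^ 2) • u = 0 → u = 0) : False := by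
  have hV := h.isOpen
  let A : E × E → E →L[ℝ] E := fun q =>
    jacobiEnd G q + (lam ^ 2 * P q ^ 2) • ContinuousLinearMap.id ℝ E
  have hsurj : ∀ q, IsUnit (A q) → Function.Surjective (A q) := fun q hq =>
    (ContinuousLinearMap.isUnit_iff_bijective.1 hq).2
  have hunit : IsUnit (A p) := by
    have hinj : Function.Injective (A p) := by
      refine (injective_iff_map_eq_zero (A p)).2 fun u hu => hκ u (by simpa [A] using hu)
    exact ContinuousLinearMap.isUnit_iff_bijective.2
      ⟨hinj, (LinearMap.injective_iff_surjective (f := (A p).toLinearMap)).1 hinj⟩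
  -- If λP = 0 then Φ itself is onto, so y lies in its image. But d_y e vanishes on that image,
  -- whereas its value at y is 2e > 0.
  have hlamP : lam * P p ≠ 0 := by
    intro h0
    obtain ⟨u, hu⟩ := hsurj p hunit p.2
    have hA : A p u = jacobiEnd G p u := by
      have : lam ^ 2 * P p ^ 2 = 0 := by rw [← mul_pow, h0]; simp
      simp [A, this]
    have h1 := fderiv_jacobiEnd_eq_zero hV hp (he.smooth p hp) (h.G_smooth p hp)
      (fun q hq => hEL.spray_eq_zero he hV hq)
      (fun q hq u => hEL.hor_eq_zero he hV hq (h.G_smooth q hq) u) u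
    rw [← hA, hu, he.euler p hp] at h1
    linarith [he.pos p hp]
  have hPc := (h.P_smooth p hp).continuousAt
  have hAc : ContinuousAt A p :=
    (jacobiEnd_continuousAt (h.G_smooth p hp)).add
      ((continuousAt_const.mul (hPc.pow 2)).smul continuousAt_const)
  -- Invertibility is an open condition, which provides ω = 0 on an open set, where it can be
  -- differentiated.
  have hev : ∀ᶠ q in nhds p, q ∈ V ∧ P q ≠ 0 ∧ IsUnit (A q) :=
    Filter.Eventually.and (hV.mem_nhds hp) ((hPc.eventually_ne (right_ne_zero_of_mul hlamP)).and
      (hAc.eventually (Units.isOpen.mem_nhds hunit)))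
  obtain ⟨W, hW, hWo, hpW⟩ := eventually_nhds_iff.1 hev
  refine (h.mono hWo fun q hq => (hW q hq).1).false_of_log_eq hdim
    (left_ne_zero_of_mul hlamP) (fun q hq => (hW q hq).2.1) (fun q hq u => ?_) hpW
  obtain ⟨u', rfl⟩ := hsurj q (hW q hq).2.2 u
  have := h.log_sub_jacobiEnd (hW q hq).1 u'
  simp only [A]
  simpa [sub_eq_zero] using this

end Deformation

/-! ### Translation from the tangent bundle to induced coordinates. -/

section Coordinates

variable {n : ℕ} {M : Type*} [TopologicalSpace M]
  [ChartedSpace (EuclideanSpace ℝ (Fin n)) M] [IsManifold (𝓡 n) ∞ M]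

local notation "𝔼" => EuclideanSpace ℝ (Fin n)

theorem coords_eq (x₀ : M) : coords x₀ =
    (trivializationAt 𝔼 (TangentSpace (𝓡 n)) x₀).toPartialEquiv ≫
      (extChartAt (𝓡 n) x₀).prod (PartialEquiv.refl 𝔼) :=
  FiberBundle.extChartAt (⟨x₀, 0⟩ : TangentBundle (𝓡 n) M)

theorem mem_coords_source (x₀ : M) (v : TangentBundle (𝓡 n) M) :
    v ∈ (coords x₀).source ↔ v.1 ∈ (chartAt 𝔼 x₀).source := by
  rw [coords, extChartAt_source]
  exact TangentBundle.mem_chart_source_iff _ _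

/-- The identification of the fibre over `b` with the model space by the chart around `x₀`. -/
def fibreCoord (x₀ b : M) : 𝔼 →L[ℝ] 𝔼 :=
  (trivializationAt 𝔼 (TangentSpace (𝓡 n)) x₀).continuousLinearMapAt ℝ b

theorem coords_apply (x₀ : M) {v : TangentBundle (𝓡 n) M} (hv : v ∈ (coords x₀).source) :
    coords x₀ v = (extChartAt (𝓡 n) x₀ v.1, fibreCoord x₀ v.1 v.2) := by
  have hb : v.1 ∈ (trivializationAt 𝔼 (TangentSpace (𝓡 n)) x₀).baseSet := by
    rw [TangentBundle.trivializationAt_baseSet]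
    exact (mem_coords_source x₀ v).1 hv
  rw [coords_eq]
  refine Prod.ext ?_ ?_
  · change extChartAt (𝓡 n) x₀ (trivializationAt 𝔼 (TangentSpace (𝓡 n)) x₀ v).1 = _
    rw [TangentBundle.trivializationAt_fst]
  · change (trivializationAt 𝔼 (TangentSpace (𝓡 n)) x₀ v).2 =
      (trivializationAt 𝔼 (TangentSpace (𝓡 n)) x₀).continuousLinearMapAt ℝ v.1 v.2
    rw [Bundle.Trivialization.continuousLinearMapAt_apply,
      Bundle.Trivialization.coe_linearMapAt_of_mem _ hb]

theorem isOpen_coords_target (x₀ : M) : IsOpen (coords (n := n) x₀).target :=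
  isOpen_extChartAt_target _

theorem isOpen_coords_source (x₀ : M) : IsOpen (coords (n := n) x₀).source :=
  isOpen_extChartAt_source _

theorem contMDiffOn_coords (x₀ : M) :
    ContMDiffOn (𝓡 n).tangent 𝓘(ℝ, 𝔼 × 𝔼) ∞ (coords x₀) (coords (n := n) x₀).source := by
  rw [coords, extChartAt_source]
  exact contMDiffOn_extChartAt

theorem contMDiffOn_coords_symm (x₀ : M) :
    ContMDiffOn 𝓘(ℝ, 𝔼 × 𝔼) (𝓡 n).tangent ∞ (coords x₀).symm (coords (n := n) x₀).target :=
  contMDiffOn_extChartAt_symm _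

theorem contMDiffAt_coords (x₀ : M) {v : TangentBundle (𝓡 n) M} (hv : v ∈ (coords x₀).source) :
    ContMDiffAt (𝓡 n).tangent 𝓘(ℝ, 𝔼 × 𝔼) ∞ (coords x₀) v :=
  (contMDiffOn_coords x₀).contMDiffAt ((isOpen_coords_source x₀).mem_nhds hv)

theorem contMDiffAt_coords_symm (x₀ : M) {p : 𝔼 × 𝔼} (hp : p ∈ (coords x₀).target) :
    ContMDiffAt 𝓘(ℝ, 𝔼 × 𝔼) (𝓡 n).tangent ∞ (coords x₀).symm p :=
  (contMDiffOn_coords_symm x₀).contMDiffAt ((isOpen_coords_target x₀).mem_nhds hp)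

/-- The domain of the induced coordinates of the slit tangent bundle. -/
def slitTarget (x₀ : M) : Set (𝔼 × 𝔼) := (coords x₀).target ∩ {p | p.2 ≠ 0}

theorem isOpen_slitTarget (x₀ : M) : IsOpen (slitTarget (n := n) x₀) :=
  (isOpen_coords_target x₀).inter (isOpen_ne.preimage continuous_snd)

theorem coords_symm_mem {x₀ : M} {p : 𝔼 × 𝔼} (hp : p ∈ (coords x₀).target) :
    (coords x₀).symm p ∈ (coords x₀).source :=
  (coords x₀).map_target hp

theorem coords_fibre {x₀ : M} {v : TangentBundle (𝓡 n) M} (hv : v ∈ (coords x₀).source) (y : 𝔼) :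
    (⟨v.1, y⟩ : TangentBundle (𝓡 n) M) ∈ (coords x₀).source ∧
      coords x₀ (⟨v.1, y⟩ : TangentBundle (𝓡 n) M) =
        ((coords x₀ v).1, fibreCoord x₀ v.1 y) := by
  have h : (⟨v.1, y⟩ : TangentBundle (𝓡 n) M) ∈ (coords x₀).source := by
    rw [mem_coords_source] at hv ⊢
    exact hv
  exact ⟨h, by rw [coords_apply x₀ h, coords_apply x₀ hv]⟩

theorem fibreCoord_coords_symm {x₀ : M} {p : 𝔼 × 𝔼} (hp : p ∈ (coords x₀).target) :
    fibreCoord x₀ ((coords x₀).symm p).1 ((coords x₀).symm p).2 = p.2 := by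
  have h := coords_apply x₀ (coords_symm_mem hp)
  rw [(coords x₀).right_inv hp] at h
  exact (congrArg Prod.snd h).symm

/-- Induced coordinates are linear on fibres, so homogeneity in y can be tested in them. -/
theorem coords_symm_smul {x₀ : M} {p : 𝔼 × 𝔼} (hp : p ∈ (coords x₀).target) (t : ℝ) :
    (p.1, t • p.2) ∈ (coords x₀).target ∧ (coords x₀).symm (p.1, t • p.2) =
      ⟨((coords x₀).symm p).1, t • ((coords x₀).symm p).2⟩ := by
  obtain ⟨h1, h2⟩ := coords_fibre (coords_symm_mem hp) (t • ((coords x₀).symm p).2 : 𝔼)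
  have h3 : fibreCoord x₀ ((coords x₀).symm p).1 (t • ((coords x₀).symm p).2) = t • p.2 := by
    rw [← fibreCoord_coords_symm hp]
    exact map_smul (fibreCoord x₀ ((coords x₀).symm p).1) t _
  rw [(coords x₀).right_inv hp, h3] at h2
  rw [← h2]
  exact ⟨(coords x₀).map_source h1, (coords x₀).left_inv h1⟩

theorem coords_symm_mem_slit {x₀ : M} {p : 𝔼 × 𝔼} (hp : p ∈ slitTarget x₀) :
    (coords x₀).symm p ∈ slit n M := by
  intro h0
  refine hp.2 ?_
  rw [← fibreCoord_coords_symm hp.1, h0]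
  exact map_zero (fibreCoord x₀ ((coords x₀).symm p).1)

theorem coords_mem_slitTarget {x₀ : M} {v : TangentBundle (𝓡 n) M} (hv : v ∈ (coords x₀).source)
    (hv0 : v ∈ slit n M) : coords x₀ v ∈ slitTarget x₀ := by
  refine ⟨(coords x₀).map_source hv, fun h0 => hv0 ?_⟩
  obtain ⟨h1, h2⟩ := coords_fibre hv (0 : 𝔼)
  have h3 : (⟨v.1, (0 : 𝔼)⟩ : TangentBundle (𝓡 n) M) = v :=
    (coords x₀).injOn h1 hv (h2.trans (Prod.ext rfl ((map_zero _).trans h0.symm)))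
  exact (congrArg (fun w : TangentBundle (𝓡 n) M => w.2 = 0) h3).mp rfl

theorem isOpen_slit : IsOpen (slit n M) := by
  refine isOpen_iff_mem_nhds.2 fun v hv => ?_
  have hvs : v ∈ (coords v.1).source := (mem_coords_source v.1 v).2 (mem_chart_source 𝔼 v.1)
  have h1 := (contMDiffAt_coords v.1 hvs).continuousAt.preimage_mem_nhds
    ((isOpen_slitTarget v.1).mem_nhds (coords_mem_slitTarget hvs hv))
  filter_upwards [h1, (isOpen_coords_source v.1).mem_nhds hvs] with w hw hws
  have := coords_symm_mem_slit hw
  rwa [(coords v.1).left_inv hws] at this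

theorem contDiffAt_funRep {x₀ : M} {f : TangentBundle (𝓡 n) M → ℝ}
    (hf : ContMDiffOn (𝓡 n).tangent 𝓘(ℝ, ℝ) ∞ f (slit n M)) {p : 𝔼 × 𝔼}
    (hp : p ∈ slitTarget x₀) : ContDiffAt ℝ ∞ (funRep x₀ f) p := by
  have h1 := hf.contMDiffAt (isOpen_slit.mem_nhds (coords_symm_mem_slit hp))
  exact (h1.comp p (contMDiffAt_coords_symm x₀ hp.1)).contDiffAt

/-- Euler's relation in the induced coordinates. -/
theorem fderiv_funRep_liouville {x₀ : M} {f : TangentBundle (𝓡 n) M → ℝ} {k : ℕ}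
    (hf : ContMDiffOn (𝓡 n).tangent 𝓘(ℝ, ℝ) ∞ f (slit n M))
    (hhom : ∀ v ∈ slit n M, ∀ t : ℝ, 0 < t → f ⟨v.1, t • v.2⟩ = t ^ k * f v) {p : 𝔼 × 𝔼}
    (hp : p ∈ slitTarget x₀) :
    fderiv ℝ (funRep x₀ f) p (0, p.2) = k * funRep x₀ f p := by
  have hd := ((contDiffAt_funRep hf hp).differentiableAt (by simp)).hasFDerivAt
  have hc : HasDerivAt (fun t : ℝ => (p.1, t • p.2)) ((0 : 𝔼), p.2) 1 := by
    simpa using (hasDerivAt_const (1 : ℝ) p.1).prodMk ((hasDerivAt_id (1 : ℝ)).smul_const p.2)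
  -- The chain rule needs the base point in the form of the ray t ↦ (x, t y) at t = 1.
  have hd' : HasFDerivAt (funRep x₀ f) (fderiv ℝ (funRep x₀ f) p) (p.1, (1 : ℝ) • p.2) := by
    simpa using hd
  have h1 := hd'.comp_hasDerivAt (1 : ℝ) hc
  have h2 : HasDerivAt (fun t : ℝ => t ^ k * funRep x₀ f p) (k * funRep x₀ f p) 1 := by
    simpa using (hasDerivAt_pow k (1 : ℝ)).mul_const (funRep x₀ f p)
  refine h1.unique (h2.congr_of_eventuallyEq ?_)
  filter_upwards [lt_mem_nhds (zero_lt_one : (0 : ℝ) < 1)] with t ht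
  simp only [Function.comp_apply, funRep, (coords_symm_smul hp.1 t).2]
  exact hhom _ (coords_symm_mem_slit hp) t ht

/-- Read in coordinates, the inclusion of a fibre is z ↦ (constant, linear in z), whose derivative
is explicit. -/
theorem vecRep_verticalLift {x₀ b : M} {y : 𝔼}
    (hv : (⟨b, y⟩ : TangentBundle (𝓡 n) M) ∈ (coords x₀).source) (w : 𝔼) :
    vecRep x₀ ⟨b, y⟩ (verticalLift ⟨b, y⟩ w) = (0, fibreCoord x₀ b w) := by
  let g : 𝔼 → 𝔼 × 𝔼 := fun z => ((coords x₀ ⟨b, y⟩).1, fibreCoord x₀ b z)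
  have hg : HasFDerivAt g ((0 : 𝔼 →L[ℝ] 𝔼).prod (fibreCoord x₀ b)) y :=
    (hasFDerivAt_const _ y).prodMk (fibreCoord x₀ b).hasFDerivAt
  have hgc : (coords x₀) ∘ (fibreIncl b) = g := by
    funext z
    exact (coords_fibre hv z).2
  have hinc : fibreIncl b = (coords x₀).symm ∘ g := by
    funext z
    rw [← hgc]
    exact ((coords x₀).left_inv (coords_fibre hv z).1).symm
  have hgt : g y ∈ (coords x₀).target := by
    rw [← hgc]
    exact (coords x₀).map_source hv
  have hmd : MDifferentiableAt 𝓘(ℝ, 𝔼) (𝓡 n).tangent (fibreIncl b) y := by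
    rw [hinc]
    exact ((contMDiffAt_coords_symm x₀ hgt).mdifferentiableAt (by simp)).comp y
      hg.differentiableAt.mdifferentiableAt
  have h := mfderiv_comp (I := 𝓘(ℝ, 𝔼)) (I' := (𝓡 n).tangent) (I'' := 𝓘(ℝ, 𝔼 × 𝔼))
    (g := coords x₀) (f := fibreIncl b) y
    ((contMDiffAt_coords x₀ hv).mdifferentiableAt (by simp)) hmd
  rw [hgc, mfderiv_eq_fderiv, hg.fderiv] at h
  exact (DFunLike.congr_fun h w).symm

theorem vecRep_liouville {x₀ : M} {v : TangentBundle (𝓡 n) M} (hv : v ∈ (coords x₀).source) :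
    vecRep x₀ v (liouville v) = (0, (coords x₀ v).2) := by
  rw [coords_apply x₀ hv]
  exact vecRep_verticalLift hv v.2

theorem fieldRep_deform {x₀ : M}
    (S : (v : TangentBundle (𝓡 n) M) → TangentSpace (𝓡 n).tangent v) (lam : ℝ)
    (P : TangentBundle (𝓡 n) M → ℝ) {p : 𝔼 × 𝔼} (hp : p ∈ (coords x₀).target) :
    fieldRep x₀ (deform S lam P) p =
      fieldRep x₀ S p - (2 * lam * funRep x₀ P p) • ((0 : 𝔼), p.2) := by
  have h := vecRep_liouville (coords_symm_mem hp)
  rw [(coords x₀).right_inv hp] at h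
  rw [← h]
  simp only [fieldRep, deform, vecRep, map_sub, map_smul]
  rfl

/-- The representative is the fibre component of the tangent map of the chart, applied to the smooth
section S along the inverse chart. -/
theorem contDiffAt_fieldRep {x₀ : M}
    {S : (v : TangentBundle (𝓡 n) M) → TangentSpace (𝓡 n).tangent v} (hS : IsSpray S)
    {p : 𝔼 × 𝔼} (hp : p ∈ slitTarget x₀) : ContDiffAt ℝ ∞ (fieldRep x₀ S) p := by
  have hso := isOpen_coords_source (n := n) x₀
  have h1 := (contMDiffOn_coords (n := n) x₀).contMDiffOn_tangentMapWithin (m := ∞) (by simp)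
    hso.uniqueMDiffOn
  have h2 := hS.smooth.contMDiffAt (isOpen_slit.mem_nhds (coords_symm_mem_slit hp))
  have h3 := h2.comp p (contMDiffAt_coords_symm x₀ hp.1)
  have h4 := h1.contMDiffAt (x := ⟨(coords x₀).symm p, S ((coords x₀).symm p)⟩)
    ((hso.preimage (FiberBundle.continuous_proj _ _)).mem_nhds (coords_symm_mem hp.1))
  have h5 := h4.comp p h3
  have h6 := ((contMDiff_snd_tangentBundle_modelSpace (𝔼 × 𝔼) 𝓘(ℝ, 𝔼 × 𝔼)).contMDiffAt.comp p
    h5).contDiffAt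
  refine h6.congr_of_eventuallyEq ?_
  filter_upwards [(isOpen_coords_target x₀).mem_nhds hp.1] with q hq
  simp only [fieldRep, vecRep]
  rw [← mfderivWithin_of_isOpen hso (coords_symm_mem hq)]
  rfl

theorem contDiffAt_sprayCoeff {x₀ : M}
    {S : (v : TangentBundle (𝓡 n) M) → TangentSpace (𝓡 n).tangent v} (hS : IsSpray S)
    {p : 𝔼 × 𝔼} (hp : p ∈ slitTarget x₀) : ContDiffAt ℝ ∞ (sprayCoeff x₀ S) p :=
  (contDiffAt_fieldRep hS hp).snd.const_smul (-(1 / 2) : ℝ)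

/-- The energy of a Finsler function in the induced coordinates. -/
theorem IsFinsler.isEnergyOn {F : TangentBundle (𝓡 n) M → ℝ} (hF : IsFinsler F) (x₀ : M) :
    IsEnergyOn (slitTarget x₀) (funRep x₀ (energy F)) := by
  have hs : ContMDiffOn (𝓡 n).tangent 𝓘(ℝ, ℝ) ∞ (energy F) (slit n M) := by
    have h : ContDiff ℝ ∞ (fun r : ℝ => r ^ 2 / 2) := by fun_prop
    exact h.contMDiff.comp_contMDiffOn hF.smooth
  refine ⟨fun p hp => contDiffAt_funRep hs hp, fun p hp => ?_, fun p hp => ?_,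
    fun p hp u hu => ?_⟩
  · have := hF.pos _ (coords_symm_mem_slit hp)
    simp only [funRep, energy]
    positivity
  · refine (fderiv_funRep_liouville (k := 2) hs (fun v _ t ht => ?_) hp).trans (by norm_num)
    rw [energy, energy, hF.homogeneous v t ht]
    ring
  · exact hF.nondegenerate x₀ p hp.1 hp.2 u hu

theorem fderiv_dJ {x₀ : M} {f : TangentBundle (𝓡 n) M → ℝ} {p : 𝔼 × 𝔼}
    (hf : ContDiffAt ℝ ∞ (funRep x₀ f) p) (ξ η : 𝔼 × 𝔼) :
    fderiv ℝ (dJ x₀ f) p ξ η = fderiv ℝ (fun q => fderiv ℝ (funRep x₀ f) q (0, η.1)) p ξ := by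
  have h : HasFDerivAt (dJ x₀ f) _ p :=
    (differentiableAt_fderiv_of_contDiffAt hf).hasFDerivAt.clm_comp (hasFDerivAt_const _ p)
  rw [h.fderiv, fderiv_fderiv_const hf]
  simp

theorem IsGeodesicSpray.eulerLagrangeOn {F : TangentBundle (𝓡 n) M → ℝ} (hF : IsFinsler F)
    {S : (v : TangentBundle (𝓡 n) M) → TangentSpace (𝓡 n).tangent v}
    (hS : IsGeodesicSpray F S) (x₀ : M) :
    EulerLagrangeOn (slitTarget x₀) (funRep x₀ (energy F)) (fieldRep x₀ S) := by
  intro p hp η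
  have hs := (hF.isEnergyOn x₀).smooth p hp
  rw [← fderiv_dJ hs, ← hS x₀ p hp.1 hp.2 η, ddJ, ← fderiv_dJ hs]

theorem EulerLagrangeOn.congr {V : Set (𝔼 × 𝔼)} {e : 𝔼 × 𝔼 → ℝ} {Z Z' : 𝔼 × 𝔼 → 𝔼 × 𝔼}
    (h : EulerLagrangeOn V e Z) (hZ : ∀ p ∈ V, Z p = Z' p) : EulerLagrangeOn V e Z' :=
  fun p hp η => by rw [← hZ p hp]; exact h p hp η

end Coordinates

/-! ### From invariance under parallel translation to vanishing horizontal derivatives. -/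

section Holonomy

variable {n : ℕ} {M : Type*} [TopologicalSpace M]
  [ChartedSpace (EuclideanSpace ℝ (Fin n)) M] [IsManifold (𝓡 n) ∞ M]
  {S : (v : TangentBundle (𝓡 n) M) → TangentSpace (𝓡 n).tangent v} {x₀ : M}

local notation "𝔼" => EuclideanSpace ℝ (Fin n)

/-- An integral curve of a horizontal lift in the induced coordinates is a parallel vector
field. -/
theorem isParallel_of_hasDerivAt {α : ℝ → 𝔼 × 𝔼} {u : 𝔼} {O : Set ℝ} (hO : IsOpen O)
    (hS : IsSpray S) (hα : ∀ t ∈ O, α t ∈ slitTarget x₀)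
    (hd : ∀ t ∈ O, HasDerivAt α (horLift (sprayCoeff x₀ S) u (α t)) t) {a b : ℝ} (hab : a < b)
    (hO' : Set.Icc a b ⊆ O) : IsParallel S (fun t => (coords x₀).symm (α t)) a b := by
  -- An integral curve is C¹ because its derivative is a continuous field evaluated along a
  -- continuous curve.
  have hαc : ContDiffOn ℝ 1 α O := by
    rw [show (1 : WithTop ℕ∞) = 0 + 1 by simp, contDiffOn_succ_iff_deriv_of_isOpen hO]
    refine ⟨fun t ht => (hd t ht).differentiableAt.differentiableWithinAt, by simp, ?_⟩
    rw [contDiffOn_zero]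
    refine ContinuousOn.congr (fun t ht => ContinuousAt.continuousWithinAt ?_)
      fun t ht => (hd t ht).deriv
    exact ContinuousAt.comp (g := horLift (sprayCoeff x₀ S) u)
      (hasFDerivAt_horLift (contDiffAt_sprayCoeff hS (hα t ht)) u).continuousAt
      (hd t ht).continuousAt
  have hγ : ContMDiffOn 𝓘(ℝ, ℝ) (𝓡 n).tangent 1 (fun t => (coords x₀).symm (α t))
      (Set.Icc a b) :=
    ((contMDiffOn_coords_symm x₀).of_le (by simp)).comp (hαc.contMDiffOn.mono hO')
      fun t ht => (hα t (hO' ht)).1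
  refine ⟨hγ, fun t ht => ⟨coords_symm_mem_slit (hα t (hO' ht)), x₀,
    coords_symm_mem (hα t (hO' ht)).1, ?_⟩⟩
  have hsrc := coords_symm_mem (hα t (hO' ht)).1
  -- Strictness of a < b enters here: derivatives within a one-point interval would not be unique.
  have huniq := (uniqueDiffOn_Icc hab).uniqueMDiffOn t ht
  have hcomp := mfderiv_comp_mfderivWithin (I := 𝓘(ℝ, ℝ)) (I' := (𝓡 n).tangent)
    (I'' := 𝓘(ℝ, 𝔼 × 𝔼)) (g := coords x₀) (f := fun t => (coords x₀).symm (α t)) t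
    ((contMDiffAt_coords x₀ hsrc).mdifferentiableAt (by simp))
    ((hγ t ht).mdifferentiableWithinAt (by simp)) huniq
  have hαd : HasFDerivWithinAt ((coords x₀) ∘ fun t => (coords x₀).symm (α t))
      (ContinuousLinearMap.toSpanSingleton ℝ (horLift (sprayCoeff x₀ S) u (α t)))
      (Set.Icc a b) t :=
    (hd t (hO' ht)).hasFDerivAt.hasFDerivWithinAt.congr
      (fun s hs => (coords x₀).right_inv (hα s (hO' hs)).1)
      ((coords x₀).right_inv (hα t (hO' ht)).1)
  rw [mfderivWithin_eq_fderivWithin, hαd.fderivWithin (uniqueDiffOn_Icc hab t ht)] at hcomp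
  have hv : vecRep x₀ ((coords x₀).symm (α t)) (mfderivWithin 𝓘(ℝ, ℝ) (𝓡 n).tangent
      (fun t => (coords x₀).symm (α t)) (Set.Icc a b) t (1 : ℝ)) =
      horLift (sprayCoeff x₀ S) u (α t) := by
    refine (DFunLike.congr_fun hcomp (1 : ℝ)).symm.trans ?_
    exact one_smul ℝ (horLift (sprayCoeff x₀ S) u (α t))
  rw [hv, (coords x₀).right_inv (hα t (hO' ht)).1]
  exact neg_add_cancel (conn (sprayCoeff x₀ S) (α t) u)

/-- A holonomy invariant function is constant along the horizontal distribution. -/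
theorem IsHolonomyInvariant.fderiv_horLift {P : TangentBundle (𝓡 n) M → ℝ}
    (hPhol : IsHolonomyInvariant S P) (hS : IsSpray S)
    (hP : ContMDiffOn (𝓡 n).tangent 𝓘(ℝ, ℝ) ∞ P (slit n M)) {p : 𝔼 × 𝔼}
    (hp : p ∈ slitTarget x₀) (u : 𝔼) :
    fderiv ℝ (funRep x₀ P) p (horLift (sprayCoeff x₀ S) u p) = 0 := by
  have hX : ContDiffAt ℝ 1 (horLift (sprayCoeff x₀ S) u) p :=
    contDiffAt_const.prodMk
      (((contDiffAt_conn (contDiffAt_sprayCoeff hS hp)).clm_apply contDiffAt_const).neg.of_le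
        (by simp))
  -- Picard-Lindelöf gives an integral curve of δ_u through p. It is a parallel field, so P is
  -- constant on it, and the chain rule at time 0 gives the claim.
  obtain ⟨α, hα0, ε, hε, hα⟩ :=
    hX.exists_forall_mem_closedBall_exists_eq_forall_mem_Ioo_hasDerivAt₀ 0
  simp only [zero_sub, zero_add] at hα
  have hα' := hα 0 (by simpa using hε)
  have hev : ∀ᶠ t in nhds (0 : ℝ), α t ∈ slitTarget x₀ :=
    hα'.continuousAt.eventually ((isOpen_slitTarget x₀).mem_nhds (by rwa [hα0]))
  obtain ⟨δ, hδ, hball⟩ := Metric.eventually_nhds_iff_ball.1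
    (hev.and (Ioo_mem_nhds (neg_lt_zero.2 hε) hε))
  have key : ∀ a b : ℝ, a ∈ Metric.ball (0 : ℝ) δ → b ∈ Metric.ball (0 : ℝ) δ → a < b →
      funRep x₀ P (α a) = funRep x₀ P (α b) := fun a b ha hb hab =>
    hPhol _ a b hab.le (isParallel_of_hasDerivAt Metric.isOpen_ball hS
      (fun t ht => (hball t ht).1) (fun t ht => hα t (hball t ht).2) hab
      ((convex_ball (0 : ℝ) δ).ordConnected.out ha hb))
  have h0 : (0 : ℝ) ∈ Metric.ball (0 : ℝ) δ := Metric.mem_ball_self hδ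
  have hconst : (fun t => funRep x₀ P (α t)) =ᶠ[nhds 0] fun _ => funRep x₀ P (α 0) := by
    filter_upwards [Metric.ball_mem_nhds (0 : ℝ) hδ] with t ht
    rcases lt_trichotomy t 0 with h | h | h
    · exact key t 0 ht h0 h
    · rw [h]
    · exact (key 0 t h0 ht h).symm
  have hd : HasFDerivAt (funRep x₀ P) (fderiv ℝ (funRep x₀ P) p) (α 0) := by
    rw [hα0]
    exact ((contDiffAt_funRep hP hp).differentiableAt (by simp)).hasFDerivAt
  have h1 := hd.comp_hasDerivAt (0 : ℝ) hα'
  rw [hα0] at h1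
  exact h1.unique ((hasDerivAt_const (0 : ℝ) _).congr_of_eventuallyEq hconst)

end Holonomy

end Finsler

end

/- The homogeneity of `P` is not used: for `lam ≠ 0` it follows from that of the coefficients
of the two metrizable sprays. -/
theorem mainTheorem2 {n : ℕ} (hn : 2 ≤ n) {M : Type*} [TopologicalSpace M]
    [ChartedSpace (EuclideanSpace ℝ (Fin n)) M] [IsManifold (𝓡 n) ∞ M]
    (S : (v : TangentBundle (𝓡 n) M) → TangentSpace (𝓡 n).tangent v)
    (hS : Finsler.IsSpray S) (hSF : Finsler.IsFinslerMetrizable S)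
    (P : TangentBundle (𝓡 n) M → ℝ)
    (hP : ContMDiffOn (𝓡 n).tangent 𝓘(ℝ, ℝ) ∞ P (Finsler.slit n M))
    (hPhom : ∀ v ∈ Finsler.slit n M, ∀ t : ℝ, 0 < t → P ⟨v.1, t • v.2⟩ = t * P v)
    (hPhol : Finsler.IsHolonomyInvariant S P)
    (lam : ℝ) (v : TangentBundle (𝓡 n) M) (hv : v ∈ Finsler.slit n M)
    (hlam : ∀ κ : ℝ, Finsler.IsJacobiEigenvalue S v κ → κ + lam ^ 2 * P v ^ 2 ≠ 0) :
    ¬ Finsler.IsFinslerMetrizable (Finsler.deform S lam P) := by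
  rintro ⟨F', hF', hEL'⟩
  obtain ⟨F, hF, hEL⟩ := hSF
  set x₀ := v.1 with hx₀
  have hvs : v ∈ (Finsler.coords x₀).source :=
    (Finsler.mem_coords_source x₀ v).2 (mem_chart_source _ x₀)
  have he := hF.isEnergyOn x₀
  have hV := Finsler.isOpen_slitTarget (n := n) x₀
  have hp := Finsler.coords_mem_slitTarget hvs hv
  have hG : ∀ p ∈ Finsler.slitTarget x₀, ContDiffAt ℝ ∞ (Finsler.sprayCoeff x₀ S) p :=
    fun p hp => Finsler.contDiffAt_sprayCoeff hS hp
  have hELe := hEL.eulerLagrangeOn hF x₀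
  have hfield : ∀ p ∈ Finsler.slitTarget x₀,
      Finsler.fieldRep x₀ S p = Finsler.sprayField (Finsler.sprayCoeff x₀ S) p := fun p hp =>
    Prod.ext (hELe.fst_eq he hV hp) (by simp [Finsler.sprayField, Finsler.sprayCoeff, smul_smul])
  have hELs := hELe.congr hfield
  have hdata : Finsler.DeformationData (Finsler.slitTarget x₀) (Finsler.sprayCoeff x₀ S)
      (Finsler.funRep x₀ P) (Finsler.funRep x₀ (Finsler.energy F')) lam :=
    { isOpen := hV
      G_smooth := hG
      G_hom := fun p hp => hELs.conn_liouville he hV hp (hG p hp)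
      P_smooth := fun p hp => Finsler.contDiffAt_funRep hP hp
      P_hor := fun p hp u => hPhol.fderiv_horLift hS hP hp u
      energy := hF'.isEnergyOn x₀
      eulerLagrange := (hEL'.eulerLagrangeOn hF' x₀).congr fun p hp => by
        rw [Finsler.fieldRep_deform S lam P hp.1, hfield p hp]
        refine Prod.ext (by simp [Finsler.sprayField]) ?_
        simp only [Finsler.sprayField, Prod.snd_sub, Prod.smul_snd]
        module }
  have hPv : Finsler.funRep x₀ P (Finsler.coords x₀ v) = P v := by
    rw [Finsler.funRep, (Finsler.coords x₀).left_inv hvs]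
  refine hdata.false (by simpa using hn) he hELs hp fun u hu => ?_
  by_contra hu0
  -- A nonzero kernel vector of Φ + λ²P² is an eigenvector of Φ for exactly the excluded eigenvalue
  -- -λ²P².
  refine hlam (-(lam ^ 2 * P v ^ 2)) ⟨u, hu0, ?_⟩ (neg_add_cancel _)
  rw [hPv] at hu
  have hjac : Finsler.jacobi v.1 S (Finsler.coords v.1 v) =
      Finsler.jacobiEnd (Finsler.sprayCoeff x₀ S) (Finsler.coords x₀ v) := by
    rw [Finsler.jacobi, Finsler.jacobiEnd, ← hfield _ hp]
    rfl
  rw [hjac, neg_smul]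
  exact eq_neg_of_add_eq_zero_left hu
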